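/- Let $\mathrm{SU}(2)$ be the group of $2\times 2$ unitary matrices of determinant one, with normalised Haar measure $du$. For $l\in\frac12\mathbb N_0=\{0,\frac12,1,\frac32,\dots\}$ let $V_l$ be the $(2l+1)$-dimensional space of homogeneous polynomials of degree $2l$ in $z=(z_1,z_2)$ with complex coefficients, and let $t^l(u)\in\mathbb C^{(2l+1)\times(2l+1)}$ be the unitary matrix, in the orthonormal basis $\frac{z_1^{k}z_2^{2l-k}}{\sqrt{k!\,(2l-k)!}}$ ($0\le k\le 2l$) of $V_l$, of the action $(t^l(u)P)(z)=P(zu)$ of $u\in \mathrm{SU}(2)$, where $z$ is a row vector. For $f\in L^1(\mathrm{SU}(2))$ put $$\widehat f(l)=\int_{\mathrm{SU}(2)} f(u)\,t^l(u)^*\,du\in\mathbb C^{(2l+1)\times(2l+1)} .$$ Write $\|A\|_{\mathtt{HS}}=\sqrt{\operatorname{Tr}(AA^*)}$ for the Hilbert–Schmidt norm and $\|A\|_{\mathtt{op}}$ for the operator norm of a matrix $A$ acting on the Euclidean space $\mathbb C^{2l+1}$. **Theorem.** Let $1<p\le 2$. There is a constant $C_p<\infty$, depending only on $p$, such that the following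 holds. If $\{\sigma(l)\}_{l\in\frac12\mathbb N_0}$ is a sequence of complex matrices $\sigma(l)\in\mathbb C^{(2l+1)\times(2l+1)}$ with $$K_\sigma:=\sup_{s>0}\; s\sum_{\substack{l\in\frac12\mathbb N_0\\ \|\sigma(l)\|_{\mathtt{op}}\ge s}}(2l+1)^2<\infty ,$$ then for every $f\in L^p(\mathrm{SU}(2))$ $$\sum_{l\in\frac12\mathbb N_0}(2l+1)^{p\left(\frac2p-\frac12\right)}\,\|\widehat f(l)\|_{\mathtt{HS}}^p\,\|\sigma(l)\|_{\mathtt{op}}^{2-p}\;\le\; C_p\,K_\sigma^{2-p}\,\|f\|_{L^p(\mathrm{SU}(2))}^p ,$$ where $0^0=1$ in the case $p=2$. -/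

import Mathlib

open MeasureTheory
open scoped ENNReal NNReal Matrix

noncomputable section

/-- The group `SU(2)` of `2 × 2` complex unitary matrices of determinant one, with the topology
induced from the space of matrices. -/
abbrev SU2 : Type := Matrix.specialUnitaryGroup (Fin 2) ℂ

namespace SU2

instance : IsTopologicalGroup SU2 where
  continuous_inv := by
    have h : Continuous fun A : SU2 => star (A : Matrix (Fin 2) (Fin 2) ℂ) :=
      continuous_star.comp continuous_subtype_val
    exact h.subtype_mk _

instance : CompactSpace SU2 := by
  have hclosed : IsClosed
      (Matrix.specialUnitaryGroup (Fin 2) ℂ : Set (Matrix (Fin 2) (Fin 2) ℂ)) := by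
    have h2 : IsClosed {A : Matrix (Fin 2) (Fin 2) ℂ | A.det = 1} :=
      isClosed_eq (Continuous.matrix_det continuous_id) continuous_const
    have h1 : IsClosed {A : Matrix (Fin 2) (Fin 2) ℂ | A * star A = 1} :=
      isClosed_eq (continuous_id.mul continuous_star) continuous_const
    convert h1.inter h2 using 1
    ext A
    simp [Matrix.mem_specialUnitaryGroup_iff, Matrix.mem_unitaryGroup_iff]
  have hball : IsCompact (Set.pi Set.univ fun _ : Fin 2 => Set.pi Set.univ fun _ : Fin 2 =>
      Metric.closedBall (0 : ℂ) 1) :=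
    isCompact_univ_pi fun _ => isCompact_univ_pi fun _ => isCompact_closedBall _ _
  refine isCompact_iff_compactSpace.mp (hball.of_isClosed_subset hclosed ?_)
  intro A hA i _ j _
  simpa using entry_norm_bound_of_unitary (Matrix.mem_specialUnitaryGroup_iff.mp hA).1 i j

instance : MeasurableSpace SU2 := borel SU2

instance : BorelSpace SU2 := ⟨rfl⟩

/-- The normalised Haar measure of the compact group `SU(2)`. -/
def haar : Measure SU2 := Measure.haarMeasure ⊤

instance : IsProbabilityMeasure haar :=
  ⟨by simpa [haar] using Measure.haarMeasure_self (K₀ := (⊤ : TopologicalSpace.PositiveCompacts SU2))⟩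

/-- The action `(u · P)(z) = P(z u)` of `SU(2)` on polynomials `P` in the two variables
`z = (z₁, z₂)`, a row vector: the variable `z_j` is replaced by `∑ i, z_i u_{ij}`. -/
def act (u : SU2) : MvPolynomial (Fin 2) ℂ →ₐ[ℂ] MvPolynomial (Fin 2) ℂ :=
  MvPolynomial.bind₁ fun j =>
    ∑ i, MvPolynomial.C ((u : Matrix (Fin 2) (Fin 2) ℂ) i j) * MvPolynomial.X i

/-- The polynomial `√(k! (n - k)!)⁻¹ z₁ᵏ z₂ⁿ⁻ᵏ`. For `k = 0, …, n` these form the standard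
basis, orthonormal for an `SU(2)`-invariant inner product, of the space `V_l`, `n = 2 l`, of
homogeneous polynomials of degree `n` in `z₁, z₂`. -/
def basisPoly (n : ℕ) (k : Fin (n + 1)) : MvPolynomial (Fin 2) ℂ :=
  MvPolynomial.C (((Real.sqrt ((k : ℕ).factorial * (n - k).factorial))⁻¹ : ℝ) : ℂ) *
    (MvPolynomial.X 0 ^ (k : ℕ) * MvPolynomial.X 1 ^ (n - k))

/-- The `m`-th coordinate with respect to `basisPoly n` of a homogeneous polynomial
of degree `n`. -/
def basisCoord (n : ℕ) (m : Fin (n + 1)) (P : MvPolynomial (Fin 2) ℂ) : ℂ :=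
  ((Real.sqrt ((m : ℕ).factorial * (n - m).factorial) : ℝ) : ℂ) *
    P.coeff (Finsupp.single 0 (m : ℕ) + Finsupp.single 1 (n - m))

/-- The unitary matrix of the irreducible representation `t^l`, `n = 2 l`, of dimension
`2 l + 1 = n + 1`: the matrix of the action of `u` on homogeneous polynomials of degree `n`
in the basis `basisPoly n`. -/
def rep (n : ℕ) (u : SU2) : Matrix (Fin (n + 1)) (Fin (n + 1)) ℂ :=
  Matrix.of fun m k => basisCoord n m (act u (basisPoly n k))

/-- The Fourier coefficient `∫ f(u) t^l(u)^* du`, `n = 2 l`, of a function on `SU(2)`; the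
integral of a matrix is taken entry by entry. -/
def fourier (f : SU2 → ℂ) (n : ℕ) : Matrix (Fin (n + 1)) (Fin (n + 1)) ℂ :=
  Matrix.of fun i j => ∫ u, f u * (rep n u)ᴴ i j ∂haar

/-- The Hilbert–Schmidt norm `√(Tr (A A^*))`. -/
def hsNorm {d : ℕ} (A : Matrix (Fin d) (Fin d) ℂ) : ℝ :=
  Real.sqrt (Matrix.trace (A * Aᴴ)).re

/-- The operator norm of a matrix acting on the Euclidean space `ℂ^d`. -/
def opNorm {d : ℕ} (A : Matrix (Fin d) (Fin d) ℂ) : ℝ :=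
  ‖Matrix.toEuclideanCLM (𝕜 := ℂ) A‖

/-- `K_σ = sup_{s > 0} s ∑_{‖σ(l)‖_op ≥ s} (2 l + 1)²`, with `l` indexed by `n = 2 l`. -/
def paleyConst (σ : (n : ℕ) → Matrix (Fin (n + 1)) (Fin (n + 1)) ℂ) : ℝ≥0∞ :=
  ⨆ (s : ℝ) (_ : 0 < s),
    ENNReal.ofReal s * ∑' n : {n : ℕ // s ≤ opNorm (σ n)}, ((n : ℕ) + 1 : ℝ≥0∞) ^ 2

end SU2

end

/-! ### Matrix entries of the representations: multiplicativity, unitarity, continuity, weights. -/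

noncomputable section

namespace SU2

/-! The inequality is a Marcinkiewicz interpolation between weak type (1,1) and strong type (2,2).
Write n = 2l, give n the weight w(n) = ‖σ‖²(n+1)², and put Tf(n) = ‖f̂(n)‖_HS / (√(n+1)‖σ‖). Where
σ(n) ≠ 0, the summand of the theorem is exactly w(n)·Tf(n)^p.

For p = 2 the norms of σ cancel, and the bound is Bessel's inequality (`tsum_hsNorm_fourier_sq_le`).
For p = 1, unitarity of t^l gives ‖f̂‖_HS ≤ √(n+1)‖f‖₁, so Tf(n) > t forces ‖σ‖ < ‖f‖₁/t. The
hypothesis on σ bounds the weight of {‖σ‖ < v} by 2Kv (`tsum_paleyWeight_le`), which is the weak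
type bound. Cutting f at height Kt in the interpolation (`tsum_weight_mul_rpow_le`) produces the
factor K^(2-p).

Bessel needs Schur orthogonality (`orthonormal_entry`). An averaged matrix intertwines two
representations; the diagonal torus kills its entries between different weights, and one group
element whose first column vanishes in no representation replaces irreducibility and Schur's lemma.
-/

open MvPolynomial in
theorem X_pow_mul_X_pow_eq_monomial (a b : ℕ) :
    (X 0 ^ a * X 1 ^ b : MvPolynomial (Fin 2) ℂ) =
      monomial (Finsupp.single 0 a + Finsupp.single 1 b) 1 := by
  rw [X_pow_eq_monomial, X_pow_eq_monomial, monomial_mul, one_mul]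

theorem exponent_inj {a b c d : ℕ} :
    (Finsupp.single 0 a + Finsupp.single 1 b : Fin 2 →₀ ℕ) =
      Finsupp.single 0 c + Finsupp.single 1 d ↔ a = c ∧ b = d := by
  constructor
  · intro h
    have h0 := DFunLike.congr_fun h 0
    have h1 := DFunLike.congr_fun h 1
    simp at h0 h1
    exact ⟨h0, h1⟩
  · rintro ⟨rfl, rfl⟩
    rfl

theorem exponent_eq (d : Fin 2 →₀ ℕ) :
    d = Finsupp.single 0 (d 0) + Finsupp.single 1 (d 1) := by
  ext i
  fin_cases i <;> simp

open MvPolynomial in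
/-- A binary form of degree `n` is the sum of its `n + 1` monomials. -/
theorem eq_sum_monomials {n : ℕ} {P : MvPolynomial (Fin 2) ℂ} (hP : P.IsHomogeneous n) :
    P = ∑ m : Fin (n + 1), C (P.coeff (Finsupp.single 0 (m : ℕ) + Finsupp.single 1 (n - m))) *
      (X 0 ^ (m : ℕ) * X 1 ^ (n - m)) := by
  ext d
  rw [exponent_eq d, coeff_sum]
  simp only [X_pow_mul_X_pow_eq_monomial, C_mul_monomial, mul_one, coeff_monomial, exponent_inj]
  by_cases hd : d 0 + d 1 = n
  · rw [Finset.sum_eq_single (⟨d 0, by omega⟩ : Fin (n + 1))]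
    · have h1 : n - d 0 = d 1 := by omega
      simp [h1]
    · intro b _ hb
      rw [if_neg]
      rintro ⟨h, -⟩
      exact hb (Fin.ext h)
    · simp
  · rw [Finset.sum_eq_zero]
    · refine hP.coeff_eq_zero ?_
      simpa [← exponent_eq d, Finsupp.degree_eq_sum] using hd
    · intro m _
      rw [if_neg]
      rintro ⟨h0, h1⟩
      have := m.2
      omega

theorem factorial_sqrt_ne_zero (n k : ℕ) :
    ((Real.sqrt ((k : ℕ).factorial * (n - k).factorial) : ℝ) : ℂ) ≠ 0 := by
  have : 0 < Real.sqrt ((k : ℕ).factorial * (n - k).factorial) := by positivity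
  exact_mod_cast this.ne'

open MvPolynomial in
theorem eq_sum_basisCoord {n : ℕ} {P : MvPolynomial (Fin 2) ℂ} (hP : P.IsHomogeneous n) :
    P = ∑ m : Fin (n + 1), C (basisCoord n m P) * basisPoly n m := by
  conv_lhs => rw [eq_sum_monomials hP]
  refine Finset.sum_congr rfl fun m _ => ?_
  rw [basisCoord, basisPoly, ← mul_assoc (C _) (C _), ← C_mul]
  congr 2
  have := factorial_sqrt_ne_zero n m
  push_cast
  field_simp

theorem isHomogeneous_basisPoly (n : ℕ) (k : Fin (n + 1)) : (basisPoly n k).IsHomogeneous n := by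
  refine MvPolynomial.IsHomogeneous.C_mul ?_ _
  have h := ((MvPolynomial.isHomogeneous_X ℂ (0 : Fin 2)).pow k).mul
    ((MvPolynomial.isHomogeneous_X ℂ (1 : Fin 2)).pow (n - k))
  convert h using 1
  omega

theorem isHomogeneous_act (u : SU2) {n : ℕ} {P : MvPolynomial (Fin 2) ℂ}
    (hP : P.IsHomogeneous n) : (act u P).IsHomogeneous n := by
  have h := hP.aeval (n := 1) (fun j : Fin 2 =>
    ∑ i, MvPolynomial.C ((u : Matrix (Fin 2) (Fin 2) ℂ) i j) * MvPolynomial.X i) (fun j =>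
      MvPolynomial.IsHomogeneous.sum _ _ _ fun i _ =>
        (MvPolynomial.isHomogeneous_X ℂ i).C_mul _)
  rw [one_mul] at h
  exact h

theorem basisCoord_sum {ι : Type*} (s : Finset ι) (n : ℕ) (m : Fin (n + 1))
    (P : ι → MvPolynomial (Fin 2) ℂ) :
    basisCoord n m (∑ i ∈ s, P i) = ∑ i ∈ s, basisCoord n m (P i) := by
  simp [basisCoord, MvPolynomial.coeff_sum, Finset.mul_sum]

theorem basisCoord_C_mul (n : ℕ) (m : Fin (n + 1)) (c : ℂ) (P : MvPolynomial (Fin 2) ℂ) :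
    basisCoord n m (MvPolynomial.C c * P) = c * basisCoord n m P := by
  simp [basisCoord, MvPolynomial.coeff_C_mul]
  ring

theorem act_C_mul (u : SU2) (c : ℂ) (P : MvPolynomial (Fin 2) ℂ) :
    act u (MvPolynomial.C c * P) = MvPolynomial.C c * act u P := by
  rw [map_mul]
  simp [act]

theorem act_mul (u v : SU2) (P : MvPolynomial (Fin 2) ℂ) : act (u * v) P = act u (act v P) := by
  have h : act (u * v) = (act u).comp (act v) := by
    refine MvPolynomial.algHom_ext fun j => ?_
    simp only [AlgHom.comp_apply]
    simp [act, Matrix.mul_apply, Fin.sum_univ_two]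
    ring
  rw [h]
  rfl

theorem rep_mul (n : ℕ) (u v : SU2) : rep n (u * v) = rep n u * rep n v := by
  ext m k
  rw [Matrix.mul_apply]
  simp only [rep, Matrix.of_apply]
  rw [act_mul, eq_sum_basisCoord (isHomogeneous_act v (isHomogeneous_basisPoly n k)),
    map_sum, basisCoord_sum]
  refine Finset.sum_congr rfl fun j _ => ?_
  rw [← eq_sum_basisCoord (isHomogeneous_act v (isHomogeneous_basisPoly n k)), act_C_mul,
    basisCoord_C_mul, mul_comm]

/-- The coefficient of `Xᵐ` in `(a X + c)ᵏ (b X + d)ⁿ⁻ᵏ`. -/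
def binaryCoeff (a b c d : ℂ) (n m k : ℕ) : ℂ :=
  ((Polynomial.C a * Polynomial.X + Polynomial.C c) ^ k *
    (Polynomial.C b * Polynomial.X + Polynomial.C d) ^ (n - k)).coeff m

-- Setting z₂ = 1 loses nothing on forms of a fixed degree, so matrix entries become coefficients of
-- one-variable polynomials.
open MvPolynomial in
theorem coeff_eq_coeff_dehomogenization {n : ℕ} {P : MvPolynomial (Fin 2) ℂ}
    (hP : P.IsHomogeneous n) (m : Fin (n + 1)) :
    P.coeff (Finsupp.single 0 (m : ℕ) + Finsupp.single 1 (n - m)) =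
      (aeval ![(Polynomial.X : Polynomial ℂ), 1] P).coeff m := by
  conv_rhs => rw [eq_sum_monomials hP]
  simp only [map_sum, map_mul, map_pow, aeval_X, algHom_C, Polynomial.finsetSum_coeff]
  simp only [Matrix.cons_val_zero, Matrix.cons_val_one, one_pow, mul_one,
    Polynomial.algebraMap_eq, Polynomial.coeff_C_mul_X_pow]
  rw [Finset.sum_eq_single m]
  · simp
  · intro b _ hb
    rw [if_neg]
    intro h
    exact hb (Fin.ext h.symm)
  · simp

theorem rep_apply (n : ℕ) (u : SU2) (m k : Fin (n + 1)) :
    rep n u m k = ((Real.sqrt ((m : ℕ).factorial * (n - m).factorial) : ℝ) : ℂ) *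
      (((Real.sqrt ((k : ℕ).factorial * (n - k).factorial) : ℝ) : ℂ))⁻¹ *
      binaryCoeff ((u : Matrix (Fin 2) (Fin 2) ℂ) 0 0) ((u : Matrix (Fin 2) (Fin 2) ℂ) 0 1)
        ((u : Matrix (Fin 2) (Fin 2) ℂ) 1 0) ((u : Matrix (Fin 2) (Fin 2) ℂ) 1 1) n m k := by
  simp only [rep, Matrix.of_apply, basisCoord]
  rw [coeff_eq_coeff_dehomogenization (isHomogeneous_act u (isHomogeneous_basisPoly n k)) m]
  rw [basisPoly, act_C_mul, map_mul, MvPolynomial.algHom_C, Polynomial.algebraMap_eq,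
    Polynomial.coeff_C_mul, mul_assoc, binaryCoeff]
  simp [act, Fin.sum_univ_two, Polynomial.algebraMap_eq]

-- Generating function in a second variable Y: the binomial expansion of (Y(aX + c) + (bX + d))ⁿ
-- collects all columns k at once.
open Polynomial in
theorem choose_mul_binaryCoeff (a b c d : ℂ) {n k : ℕ} (hk : k ≤ n) (m : ℕ) :
    (n.choose k : ℂ) * binaryCoeff a b c d n m k =
      (((Polynomial.X * C (C a * X + C c) + C (C b * X + C d)) ^ n : ℂ[X][X]).coeff k).coeff m := by
  rw [add_pow, finsetSum_coeff, Finset.sum_eq_single k]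
  · have : ((Polynomial.X * C (C a * X + C c)) ^ k * C (C b * X + C d) ^ (n - k) * (n.choose k : ℂ[X][X])
        : ℂ[X][X]) = C (C (n.choose k : ℂ) * ((C a * X + C c) ^ k * (C b * X + C d) ^ (n - k))) * X ^ k := by
      simp only [mul_pow, C_mul, C_pow, map_natCast]
      ring
    rw [this, coeff_C_mul_X_pow, if_pos rfl, coeff_C_mul, binaryCoeff]
  · intro j _ hj
    have : ((Polynomial.X * C (C a * X + C c)) ^ j * C (C b * X + C d) ^ (n - j) * (n.choose j : ℂ[X][X])
        : ℂ[X][X]) = C (C (n.choose j : ℂ) * ((C a * X + C c) ^ j * (C b * X + C d) ^ (n - j))) * X ^ j := by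
      simp only [mul_pow, C_mul, C_pow, map_natCast]
      ring
    rw [this, coeff_C_mul_X_pow, if_neg (Ne.symm hj)]
  · intro h
    simp at h
    omega

open Polynomial in
theorem coeff_coeff_swap (P : ℂ[X][X]) (i j : ℕ) :
    ((Polynomial.Bivariate.swap P).coeff i).coeff j = (P.coeff j).coeff i := by
  induction P using Polynomial.induction_on' with
  | add p q hp hq => simp [hp, hq]
  | monomial n f =>
    induction f using Polynomial.induction_on' with
    | add p q hp hq => simp only [map_add, coeff_add, hp, hq]
    | monomial m r =>
      rw [Bivariate.swap_monomial_monomial]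
      simp only [coeff_monomial]
      split_ifs <;> simp_all [coeff_monomial]

/-- The generating function is (aXY + cY + bX + d)ⁿ, and exchanging X with Y only exchanges b with
c. -/
theorem choose_mul_binaryCoeff_symm (a b c d : ℂ) {n k m : ℕ} (hk : k ≤ n) (hm : m ≤ n) :
    (n.choose k : ℂ) * binaryCoeff a b c d n m k =
      (n.choose m : ℂ) * binaryCoeff a c b d n k m := by
  rw [choose_mul_binaryCoeff a b c d hk, choose_mul_binaryCoeff a c b d hm, ← coeff_coeff_swap]
  congr 2
  rw [map_pow]
  congr 1
  simp only [map_add, map_mul, Polynomial.Bivariate.swap_X, Polynomial.Bivariate.swap_Y,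
    Polynomial.Bivariate.swap_C_C]
  ring

open Polynomial in
theorem star_binaryCoeff (a b c d : ℂ) (n m k : ℕ) :
    star (binaryCoeff a b c d n m k) = binaryCoeff (star a) (star b) (star c) (star d) n m k := by
  have h := Polynomial.coeff_map (starRingEnd ℂ) (p := ((C a * X + C c) ^ k *
    (C b * X + C d) ^ (n - k))) m
  simp only [binaryCoeff, Polynomial.map_mul, Polynomial.map_pow, Polynomial.map_add,
    Polynomial.map_C, Polynomial.map_X] at h ⊢
  exact h.symm

/-- Unitarity in disguise. The normalisation √(k!(n-k)!) of the basis is what turns the binomial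
symmetry into an honest transpose. -/
theorem rep_conjTranspose (n : ℕ) (u : SU2) : (rep n u)ᴴ = rep n u⁻¹ := by
  ext k m
  have hinv : ∀ i j, ((u⁻¹ : SU2) : Matrix (Fin 2) (Fin 2) ℂ) i j =
    star ((u : Matrix (Fin 2) (Fin 2) ℂ) j i) := fun i j => rfl
  rw [Matrix.conjTranspose_apply, rep_apply, rep_apply, hinv, hinv, hinv, hinv]
  simp only [star_mul', star_binaryCoeff, star_inv₀]
  have hk : (k : ℕ) ≤ n := by omega
  have hm : (m : ℕ) ≤ n := by omega
  set a := star ((u : Matrix (Fin 2) (Fin 2) ℂ) 0 0)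
  set b := star ((u : Matrix (Fin 2) (Fin 2) ℂ) 0 1)
  set c := star ((u : Matrix (Fin 2) (Fin 2) ℂ) 1 0)
  set d := star ((u : Matrix (Fin 2) (Fin 2) ℂ) 1 1)
  have key := choose_mul_binaryCoeff_symm a b c d hk hm
  have hsq : ∀ j : ℕ, j ≤ n → (n.choose j : ℂ) *
      (((Real.sqrt (j.factorial * (n - j).factorial) : ℝ) : ℂ) *
        ((Real.sqrt (j.factorial * (n - j).factorial) : ℝ) : ℂ)) = n.factorial := by
    intro j hj
    rw [← Complex.ofReal_mul, Real.mul_self_sqrt (by positivity)]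
    rw [← Nat.choose_mul_factorial_mul_factorial hj]
    push_cast
    ring
  have h1 := hsq k hk
  have h2 := hsq m hm
  have e1 := factorial_sqrt_ne_zero n k
  have e2 := factorial_sqrt_ne_zero n m
  have s1 : star ((Real.sqrt ((k : ℕ).factorial * (n - k).factorial) : ℝ) : ℂ) =
    ((Real.sqrt ((k : ℕ).factorial * (n - k).factorial) : ℝ) : ℂ) := Complex.conj_ofReal _
  have s2 : star ((Real.sqrt ((m : ℕ).factorial * (n - m).factorial) : ℝ) : ℂ) =
    ((Real.sqrt ((m : ℕ).factorial * (n - m).factorial) : ℝ) : ℂ) := Complex.conj_ofReal _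
  rw [s1, s2]
  set x := ((Real.sqrt ((k : ℕ).factorial * (n - k).factorial) : ℝ) : ℂ)
  set y := ((Real.sqrt ((m : ℕ).factorial * (n - m).factorial) : ℝ) : ℂ)
  have hN : (n.factorial : ℂ) ≠ 0 := by exact_mod_cast n.factorial_ne_zero
  have c2 : (n.choose m : ℂ) = n.factorial / (y * y) := by
    rw [← h2]; field_simp
  have c1 : (n.choose k : ℂ) = n.factorial / (x * x) := by
    rw [← h1]; field_simp
  rw [c1, c2] at key
  field_simp at key ⊢
  linear_combination key

theorem rep_one (n : ℕ) : rep n 1 = 1 := by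
  ext m k
  rw [rep_apply]
  simp only [binaryCoeff, OneMemClass.coe_one, Matrix.one_apply]
  by_cases h : m = k
  · subst h
    have := factorial_sqrt_ne_zero n m
    rw [mul_inv_cancel₀ this]
    simp [Polynomial.coeff_X_pow]
  · have h' : (m : ℕ) ≠ k := fun e => h (Fin.ext e)
    simp [Polynomial.coeff_X_pow, h, h']

theorem rep_mul_conjTranspose (n : ℕ) (u : SU2) : rep n u * (rep n u)ᴴ = 1 := by
  rw [rep_conjTranspose, ← rep_mul, mul_inv_cancel, rep_one]

theorem conjTranspose_mul_rep (n : ℕ) (u : SU2) : (rep n u)ᴴ * rep n u = 1 := by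
  rw [rep_conjTranspose, ← rep_mul, inv_mul_cancel, rep_one]

open Polynomial in
theorem continuous_coeff_mul {X : Type*} [TopologicalSpace X] {P Q : X → ℂ[X]}
    (hP : ∀ m, Continuous fun x => (P x).coeff m) (hQ : ∀ m, Continuous fun x => (Q x).coeff m)
    (m : ℕ) : Continuous fun x => (P x * Q x).coeff m := by
  simp only [coeff_mul]
  exact continuous_finsetSum _ fun i _ => (hP _).mul (hQ _)

open Polynomial in
theorem continuous_coeff_pow {X : Type*} [TopologicalSpace X] {P : X → ℂ[X]}
    (hP : ∀ m, Continuous fun x => (P x).coeff m) (k : ℕ) :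
    ∀ m, Continuous fun x => (P x ^ k).coeff m := by
  induction k with
  | zero => intro m; simpa using continuous_const
  | succ k ih =>
    intro m
    simp only [pow_succ]
    exact continuous_coeff_mul ih hP m

open Polynomial in
theorem continuous_coeff_linear {X : Type*} [TopologicalSpace X] {a b : X → ℂ}
    (ha : Continuous a) (hb : Continuous b) (m : ℕ) :
    Continuous fun x => (C (a x) * Polynomial.X + C (b x)).coeff m := by
  simp only [coeff_add, coeff_C_mul, coeff_C]
  refine (ha.mul continuous_const).add ?_
  split_ifs
  · exact hb
  · exact continuous_const

theorem continuous_rep_apply (n : ℕ) (m k : Fin (n + 1)) : Continuous fun u => rep n u m k := by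
  have he : ∀ i j, Continuous fun u : SU2 => (u : Matrix (Fin 2) (Fin 2) ℂ) i j := fun i j =>
    (continuous_apply j).comp ((continuous_apply i).comp continuous_subtype_val)
  simp only [rep_apply]
  exact continuous_const.mul (continuous_coeff_mul
    (continuous_coeff_pow (continuous_coeff_linear (he 0 0) (he 1 0)) _)
    (continuous_coeff_pow (continuous_coeff_linear (he 0 1) (he 1 1)) _) _)

/-- The first column of `rep n u` vanishes nowhere if the second column of `u` does not. -/
theorem rep_apply_zero_ne_zero (n : ℕ) {u : SU2} (h0 : (u : Matrix (Fin 2) (Fin 2) ℂ) 0 1 ≠ 0)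
    (h1 : (u : Matrix (Fin 2) (Fin 2) ℂ) 1 1 ≠ 0) (m : Fin (n + 1)) : rep n u m 0 ≠ 0 := by
  rw [rep_apply]
  refine mul_ne_zero (mul_ne_zero (factorial_sqrt_ne_zero n m)
    (inv_ne_zero (factorial_sqrt_ne_zero n _))) ?_
  -- The symmetry replaces a coefficient of Xᵐ by a constant term, which is u₀₁ᵐ u₁₁ⁿ⁻ᵐ.
  have h := choose_mul_binaryCoeff_symm ((u : Matrix (Fin 2) (Fin 2) ℂ) 0 0)
    ((u : Matrix (Fin 2) (Fin 2) ℂ) 0 1) ((u : Matrix (Fin 2) (Fin 2) ℂ) 1 0)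
    ((u : Matrix (Fin 2) (Fin 2) ℂ) 1 1) (n := n) (k := 0) (m := m) (by omega) (by omega)
  simp only [Nat.choose_zero_right, Nat.cast_one, one_mul] at h
  simp only [Fin.val_zero]
  rw [h]
  have hm : (m : ℕ) ≤ n := by omega
  refine mul_ne_zero (by exact_mod_cast (Nat.choose_pos hm).ne') ?_
  simp [binaryCoeff, Polynomial.coeff_zero_eq_eval_zero, h0, h1]

/-- The matrix `!![x, -conj y; y, conj x]` in `SU(2)`. -/
def ofPair (x y : ℂ) (h : x * star x + y * star y = 1) : SU2 :=
  ⟨!![x, -star y; y, star x], by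
    rw [Matrix.mem_specialUnitaryGroup_iff, Matrix.mem_unitaryGroup_iff]
    constructor
    · ext i j
      fin_cases i <;> fin_cases j <;> simp [Matrix.mul_apply, Fin.sum_univ_two] <;>
        simp at h <;> first | linear_combination h | ring
    · rw [Matrix.det_fin_two_of]
      linear_combination h⟩

theorem rep_diagonal (n : ℕ) (x : ℂ) (h : x * star x + 0 * star 0 = 1) (m k : Fin (n + 1)) :
    rep n (ofPair x 0 h) m k = if m = k then x ^ (k : ℕ) * star x ^ (n - k) else 0 := by
  rw [rep_apply]
  simp only [binaryCoeff, ofPair, Matrix.of_apply, Matrix.cons_val_zero, Matrix.cons_val_one,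
    Matrix.cons_val', star_zero, neg_zero, Polynomial.C_0, add_zero, zero_mul, zero_add]
  rw [mul_pow, ← Polynomial.C_pow, ← Polynomial.C_pow, mul_assoc (Polynomial.C _),
    Polynomial.coeff_C_mul, Polynomial.coeff_mul_C, Polynomial.coeff_X_pow]
  by_cases hmk : m = k
  · subst hmk
    have := factorial_sqrt_ne_zero n m
    rw [mul_inv_cancel₀ this]
    simp
  · have h' : (m : ℕ) ≠ k := fun e => hmk (Fin.ext e)
    simp [hmk, h']

end SU2

end

/-! ### Schur orthogonality, the L¹ bound and Bessel's inequality. -/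

noncomputable section

namespace SU2

instance : haar.IsMulLeftInvariant := by
  unfold haar
  infer_instance

theorem norm_rep_apply_le_one (n : ℕ) (u : SU2) (i j : Fin (n + 1)) : ‖rep n u i j‖ ≤ 1 :=
  entry_norm_bound_of_unitary (Matrix.mem_unitaryGroup_iff.2 (rep_mul_conjTranspose n u)) i j

theorem memLp_rep_apply (q : ℝ≥0∞) (n : ℕ) (i j : Fin (n + 1)) :
    MemLp (fun u => rep n u i j) q haar :=
  MemLp.of_bound (continuous_rep_apply n i j).aestronglyMeasurable 1
    (.of_forall fun u => norm_rep_apply_le_one n u i j)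

theorem integrable_rep_mul_star_rep (n n' : ℕ) (i a : Fin (n + 1)) (j b : Fin (n' + 1)) :
    Integrable (fun u => rep n u i a * star (rep n' u j b)) haar :=
  (memLp_rep_apply 2 n i a).integrable_mul (memLp_rep_apply 2 n' j b).star

/-- The average over `u` of `rep n u * single a b 1 * (rep n' u)ᴴ`. -/
def schurMean (n n' : ℕ) (a : Fin (n + 1)) (b : Fin (n' + 1)) :
    Matrix (Fin (n + 1)) (Fin (n' + 1)) ℂ :=
  Matrix.of fun i j => ∫ u, rep n u i a * star (rep n' u j b) ∂haar

theorem schurMean_apply (n n' : ℕ) (a : Fin (n + 1)) (b : Fin (n' + 1)) (i : Fin (n + 1))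
    (j : Fin (n' + 1)) :
    schurMean n n' a b i j = ∫ u, rep n u i a * star (rep n' u j b) ∂haar := rfl

/-- Left invariance of Haar measure under u ↦ vu; by unitarity the mean is then an intertwiner. -/
theorem schurMean_invariant (n n' : ℕ) (a : Fin (n + 1)) (b : Fin (n' + 1)) (v : SU2) :
    rep n v * schurMean n n' a b * (rep n' v)ᴴ = schurMean n n' a b := by
  ext i j
  rw [schurMean_apply, ← integral_mul_left_eq_self _ v]
  simp only [rep_mul, Matrix.mul_apply, star_sum, star_mul', Finset.sum_mul_sum]
  have hint : ∀ k l, Integrable (fun u => rep n v i k * rep n u k a *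
      (star (rep n' v j l) * star (rep n' u l b))) haar := fun k l => by
    convert (integrable_rep_mul_star_rep n n' k a l b).const_mul
      (rep n v i k * star (rep n' v j l)) using 2
    ring
  rw [integral_finsetSum _ fun k _ => integrable_finsetSum _ fun l _ => hint k l]
  simp only [Matrix.conjTranspose_apply, Finset.sum_mul, schurMean_apply]
  rw [Finset.sum_comm]
  refine Finset.sum_congr rfl fun k _ => ?_
  rw [integral_finsetSum _ fun l _ => hint k l]
  refine Finset.sum_congr rfl fun l _ => ?_
  rw [mul_right_comm, ← integral_const_mul]
  congr 1
  ext u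
  ring

theorem rep_mul_schurMean (n n' : ℕ) (a : Fin (n + 1)) (b : Fin (n' + 1)) (v : SU2) :
    rep n v * schurMean n n' a b = schurMean n n' a b * rep n' v := by
  conv_rhs => rw [← schurMean_invariant n n' a b v]
  rw [Matrix.mul_assoc _ _ (rep n' v), conjTranspose_mul_rep, Matrix.mul_one]

/-- Commuting with the diagonal torus, an intertwiner can only connect equal weights 2i - n = 2j -
n'. -/
theorem schurMean_eq_zero_of_weight_ne (n n' : ℕ) (a : Fin (n + 1)) (b : Fin (n' + 1))
    {i : Fin (n + 1)} {j : Fin (n' + 1)} (h : 2 * (i : ℤ) - n ≠ 2 * (j : ℤ) - n') :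
    schurMean n n' a b i j = 0 := by
  set q : ℤ := (2 * (i : ℤ) - n) - (2 * (j : ℤ) - n') with hq
  have hq0 : (q : ℂ) ≠ 0 := by
    rw [Int.cast_ne_zero, hq]
    exact sub_ne_zero.2 h
  -- This angle makes the two characters differ by the factor exp(qθ) = exp(πi) = -1.
  set θ : ℂ := Real.pi * Complex.I / q with hθ
  have hstar : star (Complex.exp θ) = Complex.exp (-θ) := by
    rw [Complex.star_def, ← Complex.exp_conj]
    congr 1
    simp [hθ, neg_div]
  have hx : Complex.exp θ * star (Complex.exp θ) + 0 * star 0 = 1 := by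
    rw [hstar, ← Complex.exp_add]
    simp
  have hinv := congrFun (congrFun (rep_mul_schurMean n n' a b (ofPair _ 0 hx)) i) j
  rw [Matrix.mul_apply, Matrix.mul_apply] at hinv
  simp only [rep_diagonal, ite_mul, mul_ite, zero_mul, mul_zero, Finset.sum_ite_eq,
    Finset.sum_ite_eq', Finset.mem_univ, if_true] at hinv
  rw [hstar, ← Complex.exp_nat_mul, ← Complex.exp_nat_mul, ← Complex.exp_nat_mul,
    ← Complex.exp_nat_mul, ← Complex.exp_add, ← Complex.exp_add, mul_comm] at hinv
  by_contra h0
  have he := mul_left_cancel₀ h0 hinv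
  have hi : (i : ℕ) ≤ n := by omega
  have hj : (j : ℕ) ≤ n' := by omega
  have h1 : Complex.exp (Real.pi * Complex.I) = 1 := by
    rw [← div_eq_one_iff_eq (Complex.exp_ne_zero _), ← Complex.exp_sub] at he
    rw [← he]
    congr 1
    have : (Real.pi * Complex.I : ℂ) = q * θ := by rw [hθ]; field_simp
    rw [this, hq]
    push_cast [hi, hj]
    ring
  rw [Complex.exp_pi_mul_I] at h1
  norm_num at h1

theorem exists_rep_apply_zero_ne_zero :
    ∃ v : SU2, ∀ (n : ℕ) (m : Fin (n + 1)), rep n v m 0 ≠ 0 := by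
  have h : (3 / 5 : ℂ) * star (3 / 5) + 4 / 5 * star (4 / 5) = 1 := by
    norm_num
  exact ⟨ofPair (3 / 5) (4 / 5) h, fun n m =>
    rep_apply_zero_ne_zero n (by simp [ofPair]) (by simp [ofPair]) m⟩

/-- The lowest weight -n' does not occur for n, so column 0 of the intertwiner M vanishes. In column
0 of the relation for v, only M k j times a nonzero entry of `rep n' v` survives. -/
theorem schurMean_of_lt {n n' : ℕ} (hn : n < n') (a : Fin (n + 1)) (b : Fin (n' + 1)) :
    schurMean n n' a b = 0 := by
  obtain ⟨v, hv⟩ := exists_rep_apply_zero_ne_zero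
  ext k j
  by_cases hkj : 2 * (k : ℤ) - n = 2 * (j : ℤ) - n'
  · have h := congrFun (congrFun (rep_mul_schurMean n n' a b v) k) 0
    rw [Matrix.mul_apply, Matrix.mul_apply, Finset.sum_eq_zero, Finset.sum_eq_single j] at h
    · simpa [hv n' j] using h.symm
    · intro l _ hl
      rw [schurMean_eq_zero_of_weight_ne, zero_mul]
      intro h'
      exact hl (Fin.ext (by omega))
    · simp
    · intro l _
      rw [schurMean_eq_zero_of_weight_ne, mul_zero]
      simp
      omega
  · exact schurMean_eq_zero_of_weight_ne n n' a b hkj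

theorem star_schurMean_apply (n n' : ℕ) (a : Fin (n + 1)) (b : Fin (n' + 1)) (i : Fin (n + 1))
    (j : Fin (n' + 1)) : star (schurMean n n' a b i j) = schurMean n' n b a j i := by
  rw [schurMean_apply, schurMean_apply, Complex.star_def, ← integral_conj]
  congr 1
  ext u
  simp [mul_comm]

theorem schurMean_of_ne {n n' : ℕ} (hn : n ≠ n') (a : Fin (n + 1)) (b : Fin (n' + 1)) :
    schurMean n n' a b = 0 := by
  rcases hn.lt_or_gt with h | h
  · exact schurMean_of_lt h a b
  · ext i j
    rw [← star_star (schurMean n n' a b i j), star_schurMean_apply, schurMean_of_lt h]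
    simp

/-- Before integration, the trace is already the (b, a) entry of t*t = 1. -/
theorem trace_schurMean (n : ℕ) (a b : Fin (n + 1)) :
    (schurMean n n a b).trace = if a = b then 1 else 0 := by
  simp only [Matrix.trace, Matrix.diag_apply, schurMean_apply]
  rw [← integral_finsetSum _ fun k _ => integrable_rep_mul_star_rep n n k a k b]
  have h : ∀ u, ∑ k, rep n u k a * star (rep n u k b) = if a = b then 1 else 0 := by
    intro u
    have := congrFun (congrFun (conjTranspose_mul_rep n u) b) a
    rw [Matrix.mul_apply, Matrix.one_apply] at this
    simp only [Matrix.conjTranspose_apply] at this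
    simp only [mul_comm (rep n u _ a), this, eq_comm]
  simp only [h]
  simp

/-- Weights are simple, so the intertwiner is diagonal; commuting with v equates its diagonal
entries, and the trace fixes their value. -/
theorem schurMean_self (n : ℕ) (a b : Fin (n + 1)) :
    schurMean n n a b = Matrix.diagonal fun _ => if a = b then ((n : ℂ) + 1)⁻¹ else 0 := by
  obtain ⟨v, hv⟩ := exists_rep_apply_zero_ne_zero
  have hoff : ∀ i j, i ≠ j → schurMean n n a b i j = 0 := fun i j hij =>
    schurMean_eq_zero_of_weight_ne n n a b fun h => hij (Fin.ext (by omega))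
  have hdiag : ∀ k, schurMean n n a b k k = schurMean n n a b 0 0 := by
    intro k
    have h := congrFun (congrFun (rep_mul_schurMean n n a b v) k) 0
    rw [Matrix.mul_apply, Matrix.mul_apply, Finset.sum_eq_single 0, Finset.sum_eq_single k,
      mul_comm] at h
    · exact (mul_right_cancel₀ (hv n k) h).symm
    · intro l _ hl
      rw [hoff k l hl.symm, zero_mul]
    · simp
    · intro l _ hl
      rw [hoff l 0 hl, mul_zero]
    · simp
  have htr := trace_schurMean n a b
  simp only [Matrix.trace, Matrix.diag_apply, hdiag, Finset.sum_const, Finset.card_univ,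
    Fintype.card_fin, nsmul_eq_mul] at htr
  have hn : (n : ℂ) + 1 ≠ 0 := by exact_mod_cast n.succ_ne_zero
  ext i j
  by_cases hij : i = j
  · subst hij
    rw [hdiag, Matrix.diagonal_apply_eq]
    push_cast at htr
    split_ifs at htr ⊢ with hab
    · field_simp
      linear_combination htr
    · simpa [hn] using htr
  · rw [hoff i j hij, Matrix.diagonal_apply_ne _ hij]

/-- The normalised matrix entries of all the representations `rep n`. -/
def entry (q : Σ n : ℕ, Fin (n + 1) × Fin (n + 1)) : Lp ℂ 2 haar :=
  ((Real.sqrt (q.1 + 1) : ℝ) : ℂ) • (memLp_rep_apply 2 q.1 q.2.1 q.2.2).toLp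

theorem inner_toLp_rep (n n' : ℕ) (i a : Fin (n + 1)) (j b : Fin (n' + 1)) :
    inner ℂ (memLp_rep_apply 2 n i a).toLp (memLp_rep_apply 2 n' j b).toLp =
      schurMean n' n b a j i := by
  rw [L2.inner_def, schurMean_apply]
  refine integral_congr_ae ?_
  filter_upwards [(memLp_rep_apply 2 n i a).coeFn_toLp, (memLp_rep_apply 2 n' j b).coeFn_toLp]
    with u h1 h2
  rw [h1, h2]
  simp

/-- Schur orthogonality for `SU(2)`. -/
theorem orthonormal_entry : Orthonormal ℂ entry := by
  rw [orthonormal_iff_ite]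
  rintro ⟨n, i, a⟩ ⟨n', j, b⟩
  rw [entry, entry, inner_smul_left, inner_smul_right, inner_toLp_rep]
  by_cases hn : n = n'
  · subst hn
    rw [schurMean_self, Complex.conj_ofReal, Matrix.diagonal_apply]
    by_cases hij : i = j
    · by_cases hab : a = b
      · subst hij hab
        have hn : (n : ℂ) + 1 ≠ 0 := by exact_mod_cast n.succ_ne_zero
        rw [if_pos rfl, if_pos rfl, if_pos rfl, ← mul_assoc, ← Complex.ofReal_mul,
          Real.mul_self_sqrt (by positivity)]
        push_cast
        exact mul_inv_cancel₀ hn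
      · simp [hab, Ne.symm hab]
    · simp [hij, Ne.symm hij]
  · rw [schurMean_of_ne (Ne.symm hn), if_neg (fun h => hn (congrArg Sigma.fst h))]
    simp

/-- Gives access to the triangle inequality and to Bochner integrals in a Euclidean space. -/
theorem hsNorm_eq_norm {d : ℕ} (A : Matrix (Fin d) (Fin d) ℂ) :
    hsNorm A = ‖(WithLp.toLp 2 fun q : Fin d × Fin d => A q.1 q.2 :
      EuclideanSpace ℂ (Fin d × Fin d))‖ := by
  rw [EuclideanSpace.norm_eq, hsNorm]
  congr 1
  simp only [Matrix.trace, Matrix.diag_apply, Matrix.mul_apply, Matrix.conjTranspose_apply,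
    Complex.re_sum, Fintype.sum_prod_type]
  refine Finset.sum_congr rfl fun i _ => Finset.sum_congr rfl fun j _ => ?_
  rw [Complex.star_def, Complex.mul_conj, Complex.ofReal_re, Complex.normSq_eq_norm_sq]

theorem hsNorm_nonneg {d : ℕ} (A : Matrix (Fin d) (Fin d) ℂ) : 0 ≤ hsNorm A :=
  Real.sqrt_nonneg _

theorem hsNorm_sq {d : ℕ} (A : Matrix (Fin d) (Fin d) ℂ) :
    hsNorm A ^ 2 = ∑ q : Fin d × Fin d, ‖A q.1 q.2‖ ^ 2 := by
  rw [hsNorm_eq_norm, EuclideanSpace.norm_sq_eq]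

theorem hsNorm_add_le {d : ℕ} (A B : Matrix (Fin d) (Fin d) ℂ) :
    hsNorm (A + B) ≤ hsNorm A + hsNorm B := by
  simp only [hsNorm_eq_norm]
  exact norm_add_le (WithLp.toLp 2 fun q : Fin d × Fin d => A q.1 q.2 :
      EuclideanSpace ℂ (Fin d × Fin d)) (WithLp.toLp 2 fun q : Fin d × Fin d => B q.1 q.2)

theorem hsNorm_rep_conjTranspose (n : ℕ) (u : SU2) :
    hsNorm (rep n u)ᴴ = Real.sqrt (n + 1) := by
  rw [hsNorm, Matrix.conjTranspose_conjTranspose, conjTranspose_mul_rep]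
  simp [Matrix.trace_one]

theorem integrable_mul_rep {f : SU2 → ℂ} (hf : Integrable f haar) (n : ℕ) (i j : Fin (n + 1)) :
    Integrable (fun u => f u * (rep n u)ᴴ i j) haar :=
  hf.mul_bdd (c := 1) (continuous_rep_apply n j i).star.aestronglyMeasurable
    (.of_forall fun u => by
      simpa [Matrix.conjTranspose_apply] using norm_rep_apply_le_one n u j i)

theorem fourier_add {f g : SU2 → ℂ} (hf : Integrable f haar) (hg : Integrable g haar) (n : ℕ) :
    fourier (f + g) n = fourier f n + fourier g n := by
  ext i j
  simp only [fourier, Matrix.of_apply, Matrix.add_apply, Pi.add_apply, add_mul]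
  exact integral_add (integrable_mul_rep hf n i j) (integrable_mul_rep hg n i j)

theorem fourier_congr_ae {f g : SU2 → ℂ} (h : f =ᵐ[haar] g) : fourier f = fourier g := by
  ext n i j
  refine integral_congr_ae ?_
  filter_upwards [h] with u hu
  rw [hu]

/-- The `L¹` bound on Fourier coefficients. -/
theorem hsNorm_fourier_le {f : SU2 → ℂ} (hf : Integrable f haar) (n : ℕ) :
    hsNorm (fourier f n) ≤ Real.sqrt (n + 1) * ∫ u, ‖f u‖ ∂haar := by
  -- Integrating the whole matrix as one vector keeps the factor √(n+1); bounding entry by entry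
  -- would give n+1.
  set F : SU2 → EuclideanSpace ℂ (Fin (n + 1) × Fin (n + 1)) := fun u =>
    f u • WithLp.toLp 2 fun q : Fin (n + 1) × Fin (n + 1) => (rep n u)ᴴ q.1 q.2 with hF
  have hnorm : ∀ u, ‖F u‖ = Real.sqrt (n + 1) * ‖f u‖ := by
    intro u
    rw [hF, norm_smul, ← hsNorm_eq_norm, hsNorm_rep_conjTranspose, mul_comm]
  have hint : Integrable F haar := by
    rw [integrable_piLp_iff]
    exact fun q => integrable_mul_rep hf n q.1 q.2
  have hval : (WithLp.toLp 2 fun q : Fin (n + 1) × Fin (n + 1) => fourier f n q.1 q.2 :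
      EuclideanSpace ℂ (Fin (n + 1) × Fin (n + 1))) = ∫ u, F u ∂haar := by
    ext q
    exact (EuclideanSpace.proj q :
      EuclideanSpace ℂ (Fin (n + 1) × Fin (n + 1)) →L[ℂ] ℂ).integral_comp_comm hint
  rw [hsNorm_eq_norm, hval, ← integral_const_mul]
  simp only [← hnorm]
  exact norm_integral_le_integral_norm F

/-- Bessel's inequality for the Fourier series on `SU(2)`. -/
theorem tsum_hsNorm_fourier_sq_le {f : SU2 → ℂ} (hf : MemLp f 2 haar) :
    ∑' n : ℕ, ENNReal.ofReal (((n : ℝ) + 1) * hsNorm (fourier f n) ^ 2) ≤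
      ∫⁻ u, ‖f u‖ₑ ^ 2 ∂haar := by
  -- The indices are transposed because the Fourier coefficient is taken against t*.
  have hinner : ∀ n (i a : Fin (n + 1)), ‖inner ℂ (entry ⟨n, i, a⟩) hf.toLp‖ ^ 2 =
      (n + 1) * ‖fourier f n a i‖ ^ 2 := by
    intro n i a
    rw [entry, inner_smul_left, Complex.conj_ofReal, norm_mul, mul_pow, Complex.norm_real,
      Real.norm_eq_abs, sq_abs, Real.sq_sqrt (by positivity)]
    congr 3
    rw [L2.inner_def, fourier, Matrix.of_apply]
    refine integral_congr_ae ?_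
    filter_upwards [(memLp_rep_apply 2 n i a).coeFn_toLp, hf.coeFn_toLp] with u h1 h2
    rw [h1, h2]
    simp
  have hterm : ∀ n : ℕ, ENNReal.ofReal (((n : ℝ) + 1) * hsNorm (fourier f n) ^ 2) =
      ∑' q : Fin (n + 1) × Fin (n + 1),
        ENNReal.ofReal (‖inner ℂ (entry ⟨n, q⟩) hf.toLp‖ ^ 2) := by
    intro n
    rw [tsum_fintype, ← ENNReal.ofReal_sum_of_nonneg fun _ _ => by positivity, hsNorm_sq,
      ← Equiv.sum_comp (Equiv.prodComm _ _), Finset.mul_sum]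
    congr 1
    exact Finset.sum_congr rfl fun q _ => (hinner n q.1 q.2).symm
  simp only [hterm]
  rw [← ENNReal.tsum_sigma' fun q : (Σ n : ℕ, Fin (n + 1) × Fin (n + 1)) =>
    ENNReal.ofReal (‖inner ℂ (entry q) hf.toLp‖ ^ 2),
    ← ENNReal.ofReal_tsum_of_nonneg (fun _ => by positivity)
      (orthonormal_entry.inner_products_summable hf.toLp)]
  refine (ENNReal.ofReal_le_ofReal (orthonormal_entry.tsum_inner_products_le hf.toLp)).trans ?_
  rw [ENNReal.ofReal_pow (norm_nonneg _), Lp.norm_toLp, ENNReal.ofReal_toReal hf.2.ne,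
    eLpNorm_eq_lintegral_rpow_enorm_toReal (by norm_num) (by norm_num)]
  simp only [ENNReal.toReal_ofNat]
  rw [← ENNReal.rpow_natCast, ← ENNReal.rpow_mul]
  norm_num

end SU2

end

/-! ### Marcinkiewicz interpolation on a weighted sequence space. -/

noncomputable section

theorem lintegral_Ioo_ofReal_rpow {a c : ℝ} (ha : -1 < a) (hc : 0 ≤ c) :
    ∫⁻ t in Set.Ioo 0 c, ENNReal.ofReal (t ^ a) = ENNReal.ofReal (c ^ (a + 1) / (a + 1)) := by
  rw [setLIntegral_congr Ioo_ae_eq_Ioc, ← ofReal_integral_eq_lintegral_ofReal,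
    ← intervalIntegral.integral_of_le hc, integral_rpow (Or.inl ha),
    Real.zero_rpow (by linarith), sub_zero]
  · exact (intervalIntegrable_iff_integrableOn_Ioc_of_le hc).1
      (intervalIntegral.intervalIntegrable_rpow' ha)
  · filter_upwards [ae_restrict_mem measurableSet_Ioc] with t ht
    exact Real.rpow_nonneg ht.1.le a

theorem lintegral_Ici_ofReal_rpow {a c : ℝ} (ha : a < -1) (hc : 0 < c) :
    ∫⁻ t in Set.Ici c, ENNReal.ofReal (t ^ a) = ENNReal.ofReal (-c ^ (a + 1) / (a + 1)) := by
  rw [← setLIntegral_congr Ioi_ae_eq_Ici, ← ofReal_integral_eq_lintegral_ofReal,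
    integral_Ioi_rpow_of_lt ha hc]
  · exact integrableOn_Ioi_rpow_of_lt ha hc
  · filter_upwards [ae_restrict_mem measurableSet_Ioi] with t ht
    exact Real.rpow_nonneg (hc.trans ht).le a

/-- Layer-cake formula; for x ≤ 0 both sides vanish. -/
theorem ofReal_rpow_eq_lintegral {p : ℝ} (hp : 0 < p) (x : ℝ) :
    ENNReal.ofReal x ^ p =
      ∫⁻ t in Set.Ioi (0 : ℝ), ENNReal.ofReal (p * t ^ (p - 1)) * (if t < x then 1 else 0) := by
  have h : ∀ t, ENNReal.ofReal (p * t ^ (p - 1)) * (if t < x then 1 else 0) =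
      (Set.Iio x).indicator (fun t => ENNReal.ofReal (p * t ^ (p - 1))) t := by
    intro t
    by_cases ht : t < x <;> simp [ht]
  simp only [h]
  rw [lintegral_indicator measurableSet_Iio, Measure.restrict_restrict measurableSet_Iio,
    Set.Iio_inter_Ioi]
  rcases le_total x 0 with hx | hx
  · rw [Set.Ioo_eq_empty (not_lt.2 hx), ENNReal.ofReal_of_nonpos hx, ENNReal.zero_rpow_of_pos hp]
    simp
  · simp only [ENNReal.ofReal_mul hp.le]
    rw [lintegral_const_mul' _ _ ENNReal.ofReal_ne_top, lintegral_Ioo_ofReal_rpow (by linarith) hx,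
      ENNReal.ofReal_rpow_of_nonneg hx hp.le, ← ENNReal.ofReal_mul hp.le, sub_add_cancel]
    congr 1
    field_simp

/-- The integrand of the interpolation argument: `r` is the size of the function at a point, which
is cut at height `K t`. -/
def cutKernel (p K r t : ℝ) : ℝ≥0∞ :=
  ENNReal.ofReal (p * t ^ (p - 1)) *
    (ENNReal.ofReal (4 * K / t) * (if K * t < r then ENNReal.ofReal r else 0) +
      ENNReal.ofReal (4 / t ^ 2) * (if K * t < r then 0 else ENNReal.ofReal r ^ 2))

theorem measurable_cutKernel (p K : ℝ) :
    Measurable fun z : ℝ × ℝ => cutKernel p K z.1 z.2 := by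
  have hs : MeasurableSet {z : ℝ × ℝ | K * z.2 < z.1} :=
    measurableSet_lt (by fun_prop) (by fun_prop)
  refine Measurable.mul (by fun_prop) (Measurable.add (Measurable.mul (by fun_prop) ?_)
    (Measurable.mul (by fun_prop) ?_))
  · exact Measurable.ite hs (by fun_prop) measurable_const
  · exact Measurable.ite hs measurable_const (by fun_prop)

/-- The kernel changes form at t = r/K. Below, it is a multiple of t^(p-2), integrable at 0 since p
> 1; above, of t^(p-3), integrable at infinity since p < 2. Both pieces scale as K^(2-p) r^p. -/
theorem lintegral_cutKernel_le {p K r : ℝ} (hp1 : 1 < p) (hp2 : p < 2) (hK : 0 < K) (hr : 0 ≤ r) :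
    ∫⁻ t in Set.Ioi (0 : ℝ), cutKernel p K r t ≤
      ENNReal.ofReal ((4 * p / (p - 1) + 4 * p / (2 - p)) * K ^ (2 - p) * r ^ p) := by
  rcases hr.eq_or_lt with rfl | hr
  · refine (setLIntegral_congr_fun (g := fun _ => 0) measurableSet_Ioi fun t _ => ?_).trans_le
      (by simp)
    simp [cutKernel]
  set c := r / K with hc
  have hc0 : 0 < c := div_pos hr hK
  have hpt : ∀ t ∈ Set.Ioi (0 : ℝ), cutKernel p K r t ≤
      (Set.Ioo 0 c).indicator (fun t => ENNReal.ofReal (4 * p * K * r) *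
        ENNReal.ofReal (t ^ (p - 2))) t +
      (Set.Ici c).indicator (fun t => ENNReal.ofReal (4 * p * r ^ 2) *
        ENNReal.ofReal (t ^ (p - 3))) t := by
    intro t ht
    have ht : 0 < t := ht
    have hp0 : 0 < p := by linarith
    by_cases htr : K * t < r
    · have h1 : t ∈ Set.Ioo 0 c := ⟨ht, by rw [hc, lt_div_iff₀ hK]; linarith⟩
      have h2 : t ∉ Set.Ici c := fun h => absurd h1.2 (not_lt.2 h)
      rw [Set.indicator_of_mem h1, Set.indicator_of_notMem h2, cutKernel, if_pos htr, if_pos htr,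
        mul_zero, add_zero, add_zero, ← ENNReal.ofReal_mul (by positivity),
        ← ENNReal.ofReal_mul (by positivity), ← ENNReal.ofReal_mul (by positivity)]
      refine le_of_eq (congrArg _ ?_)
      rw [show p - 1 = (p - 2) + 1 by ring, Real.rpow_add_one ht.ne']
      field_simp
    · have h2 : t ∈ Set.Ici c := by
        rw [Set.mem_Ici, hc, div_le_iff₀ hK]
        linarith
      have h1 : t ∉ Set.Ioo 0 c := fun h => absurd h.2 (not_lt.2 h2)
      rw [Set.indicator_of_mem h2, Set.indicator_of_notMem h1, cutKernel, if_neg htr, if_neg htr,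
        mul_zero, zero_add, zero_add, ← ENNReal.ofReal_pow hr.le,
        ← ENNReal.ofReal_mul (by positivity),
        ← ENNReal.ofReal_mul (by positivity), ← ENNReal.ofReal_mul (by positivity)]
      refine le_of_eq (congrArg _ ?_)
      rw [show p - 1 = (p - 3) + 1 + 1 by ring, Real.rpow_add_one ht.ne', Real.rpow_add_one ht.ne']
      field_simp
  have h1 : 0 < p - 1 := by linarith
  have h2 : 0 < 2 - p := by linarith
  refine (setLIntegral_mono' measurableSet_Ioi hpt).trans ?_
  rw [lintegral_add_left (Measurable.indicator (by fun_prop) measurableSet_Ioo),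
    lintegral_indicator measurableSet_Ioo, lintegral_indicator measurableSet_Ici,
    Measure.restrict_restrict measurableSet_Ioo, Measure.restrict_restrict measurableSet_Ici,
    Set.inter_eq_left.2 Set.Ioo_subset_Ioi_self,
    Set.inter_eq_left.2 (Set.Ici_subset_Ioi.2 hc0),
    lintegral_const_mul' _ _ ENNReal.ofReal_ne_top, lintegral_const_mul' _ _ ENNReal.ofReal_ne_top,
    lintegral_Ioo_ofReal_rpow (by linarith) hc0.le, lintegral_Ici_ofReal_rpow (by linarith) hc0,
    ← ENNReal.ofReal_mul (by positivity), ← ENNReal.ofReal_mul (by positivity)]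
  have e1 : 4 * p * K * r * (c ^ (p - 2 + 1) / (p - 2 + 1)) =
      4 * p / (p - 1) * K ^ (2 - p) * r ^ p := by
    rw [hc, Real.div_rpow hr.le hK.le, show p - 2 + 1 = p - 1 by ring,
      Real.rpow_sub_one hr.ne', Real.rpow_sub_one hK.ne', Real.rpow_sub hK, Real.rpow_two]
    have := Real.rpow_pos_of_pos hK p
    field_simp
  have e2 : 4 * p * r ^ 2 * (-c ^ (p - 3 + 1) / (p - 3 + 1)) =
      4 * p / (2 - p) * K ^ (2 - p) * r ^ p := by
    rw [hc, Real.div_rpow hr.le hK.le, show p - 3 + 1 = p - 2 by ring,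
      Real.rpow_sub hr, Real.rpow_sub hK, Real.rpow_sub hK, Real.rpow_two, Real.rpow_two]
    have := Real.rpow_pos_of_pos hK p
    have h3 : p - 2 ≠ 0 := by linarith
    field_simp
    ring
  rw [e1, e2, ← ENNReal.ofReal_add (by positivity) (by positivity)]
  refine le_of_eq (congrArg _ ?_)
  ring

/-- The interpolation step between a weak type `(1, 1)` bound with constant `2 K` and a strong type
`(2, 2)` bound with constant `1`. -/
theorem tsum_weight_mul_rpow_le {X : Type*} [MeasurableSpace X] {μ : Measure X} [IsFiniteMeasure μ]
    {w : ℕ → ℝ≥0∞} {T : (X → ℂ) → ℕ → ℝ} {K : ℝ} (hK : 0 < K)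
    (hsub : ∀ g h, Integrable g μ → Integrable h μ → ∀ n, T (g + h) n ≤ T g n + T h n)
    (hweak : ∀ g, Integrable g μ → ∀ t : ℝ, 0 < t →
      ∑' n, w n * (if t < T g n then 1 else 0) ≤ ENNReal.ofReal (2 * K / t) * ∫⁻ x, ‖g x‖ₑ ∂μ)
    (hstrong : ∀ g, MemLp g 2 μ →
      ∑' n, w n * ENNReal.ofReal (T g n) ^ 2 ≤ ∫⁻ x, ‖g x‖ₑ ^ 2 ∂μ)
    {p : ℝ} (hp1 : 1 < p) (hp2 : p < 2) {f : X → ℂ} (hf : Measurable f) (hfi : Integrable f μ) :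
    ∑' n, w n * ENNReal.ofReal (T f n) ^ p ≤
      ENNReal.ofReal ((4 * p / (p - 1) + 4 * p / (2 - p)) * K ^ (2 - p)) *
        ∫⁻ x, ‖f x‖ₑ ^ p ∂μ := by
  have hp0 : 0 < p := by linarith
  have hcut : ∀ t : ℝ, 0 < t → ENNReal.ofReal (p * t ^ (p - 1)) *
      ∑' n, w n * (if t < T f n then 1 else 0) ≤ ∫⁻ x, cutKernel p K ‖f x‖ t ∂μ := by
    intro t ht
    -- The cut depends on the level t: the large part of f gets the weak bound, the small part,
    -- bounded and hence in L², the strong one.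
    set S : Set X := {x | K * t < ‖f x‖} with hS
    have hSm : MeasurableSet S := measurableSet_lt measurable_const hf.norm
    have hsum : f = S.indicator f + Sᶜ.indicator f := (Set.indicator_self_add_compl S f).symm
    have hi1 : Integrable (S.indicator f) μ := hfi.indicator hSm
    have hi2 : Integrable (Sᶜ.indicator f) μ := hfi.indicator hSm.compl
    have hL2 : MemLp (Sᶜ.indicator f) 2 μ := by
      refine MemLp.of_bound hi2.aestronglyMeasurable (K * t) (.of_forall fun x => ?_)
      by_cases hx : x ∈ S
      · simp [hx]
        positivity
      · rw [Set.indicator_of_mem hx]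
        exact not_lt.1 hx
    -- If Tf > t, then T exceeds t/2 on one of the two parts; for the small part Chebyshev's
    -- inequality supplies 4/t².
    have hn : ∀ n, w n * (if t < T f n then 1 else 0) ≤
        w n * (if t / 2 < T (S.indicator f) n then 1 else 0) +
          ENNReal.ofReal (4 / t ^ 2) * (w n * ENNReal.ofReal (T (Sᶜ.indicator f) n) ^ 2) := by
      intro n
      rw [mul_left_comm, ← mul_add]
      refine mul_le_mul_right ?_ _
      by_cases h : t < T f n
      · by_cases h1 : t / 2 < T (S.indicator f) n
        · simp [h, h1]
        · have h2 : t / 2 < T (Sᶜ.indicator f) n := by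
            have := hsub _ _ hi1 hi2 n
            rw [← hsum] at this
            linarith
          have h3 : 0 ≤ T (Sᶜ.indicator f) n := by linarith
          rw [if_pos h, if_neg h1, zero_add, ← ENNReal.ofReal_pow h3,
            ← ENNReal.ofReal_mul (by positivity), ENNReal.one_le_ofReal, div_mul_eq_mul_div,
            one_le_div (by positivity)]
          nlinarith
      · simp [h]
    have hmain : ∑' n, w n * (if t < T f n then 1 else 0) ≤
        ENNReal.ofReal (4 * K / t) * ∫⁻ x, ‖S.indicator f x‖ₑ ∂μ +
          ENNReal.ofReal (4 / t ^ 2) * ∫⁻ x, ‖Sᶜ.indicator f x‖ₑ ^ 2 ∂μ := by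
      refine (ENNReal.tsum_le_tsum hn).trans ?_
      rw [ENNReal.tsum_add, ENNReal.tsum_mul_left]
      refine add_le_add ?_ (mul_le_mul_right (hstrong _ hL2) _)
      have h := hweak _ hi1 (t / 2) (by positivity)
      rwa [show 2 * K / (t / 2) = 4 * K / t by rw [div_div_eq_mul_div]; ring] at h
    refine (mul_le_mul_right hmain _).trans (le_of_eq ?_)
    simp only [cutKernel]
    have hm1 : Measurable fun x => if K * t < ‖f x‖ then ENNReal.ofReal ‖f x‖ else 0 :=
      Measurable.ite hSm (by fun_prop) measurable_const
    have hm2 : Measurable fun x => if K * t < ‖f x‖ then 0 else ENNReal.ofReal ‖f x‖ ^ 2 :=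
      Measurable.ite hSm measurable_const (by fun_prop)
    have hI1 : ∫⁻ x, ‖S.indicator f x‖ₑ ∂μ =
        ∫⁻ x, (if K * t < ‖f x‖ then ENNReal.ofReal ‖f x‖ else 0) ∂μ := by
      refine lintegral_congr fun x => ?_
      by_cases hx : K * t < ‖f x‖
      · rw [if_pos hx, Set.indicator_of_mem (show x ∈ S from hx), ofReal_norm]
      · rw [if_neg hx, Set.indicator_of_notMem (show x ∉ S from hx), enorm_zero]
    have hI2 : ∫⁻ x, ‖Sᶜ.indicator f x‖ₑ ^ 2 ∂μ =
        ∫⁻ x, (if K * t < ‖f x‖ then 0 else ENNReal.ofReal ‖f x‖ ^ 2) ∂μ := by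
      refine lintegral_congr fun x => ?_
      by_cases hx : K * t < ‖f x‖
      · rw [if_pos hx, Set.indicator_of_notMem (not_not.2 (show x ∈ S from hx))]
        simp
      · rw [if_neg hx, Set.indicator_of_mem (show x ∈ Sᶜ from hx), ofReal_norm]
    rw [lintegral_const_mul' _ _ ENNReal.ofReal_ne_top,
      lintegral_add_left (hm1.const_mul _), lintegral_const_mul' _ _ ENNReal.ofReal_ne_top,
      lintegral_const_mul' _ _ ENNReal.ofReal_ne_top, hI1, hI2]
  calc ∑' n, w n * ENNReal.ofReal (T f n) ^ p
      = ∑' n, ∫⁻ t in Set.Ioi (0 : ℝ), ENNReal.ofReal (p * t ^ (p - 1)) *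
          (w n * (if t < T f n then 1 else 0)) := by
        refine tsum_congr fun n => ?_
        rw [ofReal_rpow_eq_lintegral hp0, ← lintegral_const_mul]
        · simp only [mul_left_comm]
        · exact Measurable.mul (by fun_prop)
            (Measurable.ite measurableSet_Iio measurable_const measurable_const)
    _ = ∫⁻ t in Set.Ioi (0 : ℝ), ENNReal.ofReal (p * t ^ (p - 1)) *
          ∑' n, w n * (if t < T f n then 1 else 0) := by
        rw [← lintegral_tsum]
        · simp only [ENNReal.tsum_mul_left]
        · intro n
          exact (Measurable.mul (by fun_prop) (Measurable.const_mul
            (Measurable.ite measurableSet_Iio measurable_const measurable_const) _)).aemeasurable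
    _ ≤ ∫⁻ t in Set.Ioi (0 : ℝ), ∫⁻ x, cutKernel p K ‖f x‖ t ∂μ :=
        setLIntegral_mono' measurableSet_Ioi hcut
    _ = ∫⁻ x, (∫⁻ t in Set.Ioi (0 : ℝ), cutKernel p K ‖f x‖ t) ∂μ := by
        refine lintegral_lintegral_swap (Measurable.aemeasurable ?_)
        exact (measurable_cutKernel p K).comp
          ((hf.norm.comp measurable_snd).prodMk measurable_fst)
    _ ≤ ∫⁻ x, ENNReal.ofReal ((4 * p / (p - 1) + 4 * p / (2 - p)) * K ^ (2 - p)) *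
          ‖f x‖ₑ ^ p ∂μ := by
        refine lintegral_mono fun x => ?_
        refine (lintegral_cutKernel_le hp1 hp2 hK (norm_nonneg _)).trans (le_of_eq ?_)
        have h1 : 0 < p - 1 := by linarith
        have h2 : 0 < 2 - p := by linarith
        rw [ENNReal.ofReal_mul (by positivity), ← ENNReal.ofReal_rpow_of_nonneg (norm_nonneg _) hp0.le,
          ofReal_norm]
    _ = _ := lintegral_const_mul' _ _ ENNReal.ofReal_ne_top

/-! ### The two endpoint bounds for the Paley operator. -/

namespace SU2

variable {σ : (n : ℕ) → Matrix (Fin (n + 1)) (Fin (n + 1)) ℂ}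

theorem opNorm_nonneg {d : ℕ} (A : Matrix (Fin d) (Fin d) ℂ) : 0 ≤ opNorm A := norm_nonneg _

theorem ofReal_mul_tsum_le_paleyConst (σ : (n : ℕ) → Matrix (Fin (n + 1)) (Fin (n + 1)) ℂ)
    {s : ℝ} (hs : 0 < s) :
    ENNReal.ofReal s * ∑' n : ℕ, (if s ≤ opNorm (σ n) then ((n : ℝ≥0∞) + 1) ^ 2 else 0) ≤
      paleyConst σ := by
  have h := le_iSup₂ (f := fun (s : ℝ) (_ : 0 < s) =>
    ENNReal.ofReal s * ∑' n : {n : ℕ // s ≤ opNorm (σ n)}, ((n : ℕ) + 1 : ℝ≥0∞) ^ 2) s hs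
  refine le_trans (le_of_eq ?_) h
  congr 1
  exact (tsum_subtype {n : ℕ | s ≤ opNorm (σ n)} fun n => ((n : ℝ≥0∞) + 1) ^ 2).symm

/-- Test the supremum at s = ‖σ(n)‖. This settles the degenerate case, as interpolation needs K > 0.
-/
theorem opNorm_eq_zero_of_paleyConst_eq_zero (h : paleyConst σ = 0) (n : ℕ) :
    opNorm (σ n) = 0 := by
  by_contra hn
  have hpos : 0 < opNorm (σ n) := lt_of_le_of_ne (opNorm_nonneg _) (Ne.symm hn)
  have h1 := ofReal_mul_tsum_le_paleyConst σ hpos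
  rw [h, nonpos_iff_eq_zero, mul_eq_zero, ENNReal.tsum_eq_zero, ENNReal.ofReal_eq_zero] at h1
  rcases h1 with h1 | h1
  · linarith
  · simpa using h1 n

/-- The weight `‖σ(l)‖² (2 l + 1)²` of the interpolation argument. -/
def paleyWeight (σ : (n : ℕ) → Matrix (Fin (n + 1)) (Fin (n + 1)) ℂ) (n : ℕ) : ℝ≥0∞ :=
  ENNReal.ofReal (opNorm (σ n) ^ 2) * ((n : ℝ≥0∞) + 1) ^ 2

/-- Write ‖σ‖² as the integral of 2s over 0 < s < ‖σ‖ and exchange sum and integral: for each s in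
(0, v) the integrand is at most 2K. -/
theorem tsum_paleyWeight_le (σ : (n : ℕ) → Matrix (Fin (n + 1)) (Fin (n + 1)) ℂ) (v : ℝ) :
    ∑' n, paleyWeight σ n * (if opNorm (σ n) < v then 1 else 0) ≤
      2 * paleyConst σ * ENNReal.ofReal v := by
  have hn : ∀ n, paleyWeight σ n * (if opNorm (σ n) < v then 1 else 0) ≤
      ∫⁻ s in Set.Ioo 0 v, ENNReal.ofReal (2 * s) *
        (if s ≤ opNorm (σ n) then ((n : ℝ≥0∞) + 1) ^ 2 else 0) := by
    intro n
    by_cases hv : opNorm (σ n) < v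
    · rw [if_pos hv, mul_one]
      refine le_trans (le_of_eq ?_)
        (lintegral_mono_set (Set.Ioo_subset_Ioo_right hv.le))
      have hd : ((n : ℝ≥0∞) + 1) ^ 2 ≠ ⊤ := by finiteness
      rw [setLIntegral_congr_fun (g := fun s => ENNReal.ofReal 2 * ((n : ℝ≥0∞) + 1) ^ 2 *
        ENNReal.ofReal (s ^ (1 : ℝ))) measurableSet_Ioo]
      · rw [lintegral_const_mul' _ _ (ENNReal.mul_ne_top ENNReal.ofReal_ne_top hd),
          lintegral_Ioo_ofReal_rpow (by norm_num) (opNorm_nonneg _), mul_right_comm,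
          ← ENNReal.ofReal_mul (by norm_num), paleyWeight]
        congr 2
        norm_num
        ring
      · intro s hs
        simp only
        rw [if_pos hs.2.le, Real.rpow_one, ENNReal.ofReal_mul (by norm_num)]
        ring
    · simp [hv]
  refine (ENNReal.tsum_le_tsum hn).trans ?_
  rw [← lintegral_tsum]
  · calc ∫⁻ s in Set.Ioo 0 v, ∑' n : ℕ, ENNReal.ofReal (2 * s) *
          (if s ≤ opNorm (σ n) then ((n : ℝ≥0∞) + 1) ^ 2 else 0)
        ≤ ∫⁻ s in Set.Ioo 0 v, 2 * paleyConst σ := by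
          refine setLIntegral_mono' measurableSet_Ioo fun s hs => ?_
          rw [ENNReal.tsum_mul_left, ENNReal.ofReal_mul (by norm_num), mul_assoc]
          refine mul_le_mul' (by simp) (ofReal_mul_tsum_le_paleyConst σ hs.1)
      _ = 2 * paleyConst σ * ENNReal.ofReal v := by simp
  · intro n
    exact (Measurable.mul (by fun_prop)
      (Measurable.ite measurableSet_Iic measurable_const measurable_const)).aemeasurable

/-- The operator `f ↦ ‖f̂(l)‖_HS / (√(2 l + 1) ‖σ(l)‖)` which is interpolated. -/
def paleyOp (σ : (n : ℕ) → Matrix (Fin (n + 1)) (Fin (n + 1)) ℂ) (f : SU2 → ℂ) (n : ℕ) : ℝ :=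
  hsNorm (fourier f n) / (Real.sqrt (n + 1) * opNorm (σ n))

theorem paleyOp_add_le {g h : SU2 → ℂ} (hg : Integrable g haar) (hh : Integrable h haar) (n : ℕ) :
    paleyOp σ (g + h) n ≤ paleyOp σ g n + paleyOp σ h n := by
  rw [paleyOp, paleyOp, paleyOp, ← add_div, fourier_add hg hh]
  exact div_le_div_of_nonneg_right (hsNorm_add_le _ _)
    (mul_nonneg (Real.sqrt_nonneg _) (opNorm_nonneg _))

theorem tsum_paleyWeight_mul_paleyOp_sq_le {g : SU2 → ℂ} (hg : MemLp g 2 haar) :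
    ∑' n, paleyWeight σ n * ENNReal.ofReal (paleyOp σ g n) ^ 2 ≤ ∫⁻ u, ‖g u‖ₑ ^ 2 ∂haar := by
  refine (ENNReal.tsum_le_tsum fun n => ?_).trans (tsum_hsNorm_fourier_sq_le hg)
  have hd : ((n : ℝ≥0∞) + 1) ^ 2 = ENNReal.ofReal (((n : ℝ) + 1) ^ 2) := by
    rw [ENNReal.ofReal_pow (by positivity), ENNReal.ofReal_add (by positivity) zero_le_one]
    simp
  have h0 : 0 ≤ paleyOp σ g n :=
    div_nonneg (hsNorm_nonneg _) (mul_nonneg (Real.sqrt_nonneg _) (opNorm_nonneg _))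
  rw [paleyWeight, hd, ← ENNReal.ofReal_pow h0, ← ENNReal.ofReal_mul (by positivity),
    ← ENNReal.ofReal_mul (by positivity)]
  refine ENNReal.ofReal_le_ofReal ?_
  rw [paleyOp, div_pow, mul_pow, Real.sq_sqrt (by positivity)]
  -- If σ(n) = 0, the weight vanishes and the left side is 0; otherwise the norms of σ cancel.
  rcases (opNorm_nonneg (σ n)).eq_or_lt with h | h
  · rw [← h]
    simp
    positivity
  · refine le_of_eq ?_
    field_simp

theorem tsum_paleyWeight_paleyOp_gt_le (hσ : paleyConst σ ≠ ⊤) {g : SU2 → ℂ}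
    (hg : Integrable g haar) {t : ℝ} (ht : 0 < t) :
    ∑' n, paleyWeight σ n * (if t < paleyOp σ g n then 1 else 0) ≤
      ENNReal.ofReal (2 * (paleyConst σ).toReal / t) * ∫⁻ u, ‖g u‖ₑ ∂haar := by
  have hlt : ∀ n, t < paleyOp σ g n → opNorm (σ n) < (∫ u, ‖g u‖ ∂haar) / t := by
    intro n hn
    -- Division by zero gives 0, so an index with σ(n) = 0 never exceeds the level t.
    have hpos : 0 < opNorm (σ n) := by
      refine lt_of_le_of_ne (opNorm_nonneg _) fun h => ?_
      rw [paleyOp, ← h, mul_zero, div_zero] at hn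
      linarith
    rw [paleyOp, lt_div_iff₀ (by positivity)] at hn
    have h1 := hn.trans_le (hsNorm_fourier_le hg n)
    rw [lt_div_iff₀ ht]
    refine lt_of_mul_lt_mul_left (a := Real.sqrt (n + 1)) ?_ (Real.sqrt_nonneg _)
    linarith
  refine (ENNReal.tsum_le_tsum fun n => mul_le_mul_right ?_ _).trans
    ((tsum_paleyWeight_le σ ((∫ u, ‖g u‖ ∂haar) / t)).trans (le_of_eq ?_))
  · by_cases hn : t < paleyOp σ g n
    · simp [hn, hlt n hn]
    · simp [hn]
  · rw [← ofReal_integral_norm_eq_lintegral_enorm hg, ← ENNReal.ofReal_mul (by positivity),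
      div_mul_eq_mul_div, mul_div_assoc, ENNReal.ofReal_mul (by positivity),
      ENNReal.ofReal_mul (by norm_num), ENNReal.ofReal_toReal hσ]
    simp

/-- Exponent count: n+1 carries 2 - p/2 = p(2/p - 1/2) and ‖σ‖ carries 2 - p. If σ(n) = 0, the left
side vanishes only because p < 2. -/
theorem summand_le_paleyWeight_mul {p : ℝ} (hp0 : 0 < p) (hp2 : p < 2) (f : SU2 → ℂ) (n : ℕ) :
    ENNReal.ofReal (((n : ℝ) + 1) ^ (p * (2 / p - 1 / 2)) * hsNorm (fourier f n) ^ p *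
      opNorm (σ n) ^ (2 - p)) ≤ paleyWeight σ n * ENNReal.ofReal (paleyOp σ f n) ^ p := by
  have hd : ((n : ℝ≥0∞) + 1) ^ 2 = ENNReal.ofReal (((n : ℝ) + 1) ^ 2) := by
    rw [ENNReal.ofReal_pow (by positivity), ENNReal.ofReal_add (by positivity) zero_le_one]
    simp
  have h0 : 0 ≤ paleyOp σ f n :=
    div_nonneg (hsNorm_nonneg _) (mul_nonneg (Real.sqrt_nonneg _) (opNorm_nonneg _))
  rw [paleyWeight, hd, ENNReal.ofReal_rpow_of_nonneg h0 hp0.le,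
    ← ENNReal.ofReal_mul (by positivity), ← ENNReal.ofReal_mul (by positivity)]
  refine ENNReal.ofReal_le_ofReal ?_
  rcases (opNorm_nonneg (σ n)).eq_or_lt with h | h
  · rw [← h, Real.zero_rpow (by linarith)]
    simp
  · have hn : (0 : ℝ) < (n : ℝ) + 1 := by positivity
    rw [paleyOp, Real.div_rpow (hsNorm_nonneg _) (by positivity),
      Real.mul_rpow (Real.sqrt_nonneg _) h.le, Real.rpow_sub h, Real.sqrt_eq_rpow,
      ← Real.rpow_mul hn.le, show p * (2 / p - 1 / 2) = 2 - 1 / 2 * p by field_simp,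
      Real.rpow_sub hn, Real.rpow_two, Real.rpow_two]
    have := Real.rpow_pos_of_pos h p
    have := Real.rpow_pos_of_pos hn (1 / 2 * p)
    refine le_of_eq ?_
    field_simp

end SU2

end

/-! ### Assembly of the theorem. -/

theorem theorem2p3 (p : ℝ) (hp1 : 1 < p) (hp2 : p ≤ 2) :
    ∃ C : ℝ≥0, ∀ σ : (n : ℕ) → Matrix (Fin (n + 1)) (Fin (n + 1)) ℂ,
      SU2.paleyConst σ < ⊤ →
      ∀ f : SU2 → ℂ, MemLp f (ENNReal.ofReal p) SU2.haar →
        ∑' n : ℕ, ENNReal.ofReal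
            (((n : ℝ) + 1) ^ (p * (2 / p - 1 / 2)) * SU2.hsNorm (SU2.fourier f n) ^ p *
              SU2.opNorm (σ n) ^ (2 - p)) ≤
          (C : ℝ≥0∞) * SU2.paleyConst σ ^ (2 - p) *
            eLpNorm f (ENNReal.ofReal p) SU2.haar ^ p := by
  have hp0 : 0 < p := by linarith
  have hnorm : ∀ g : SU2 → ℂ, eLpNorm g (ENNReal.ofReal p) SU2.haar ^ p =
      ∫⁻ u, ‖g u‖ₑ ^ p ∂SU2.haar := by
    intro g
    rw [eLpNorm_eq_lintegral_rpow_enorm_toReal (by simpa using hp0) ENNReal.ofReal_ne_top,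
      ENNReal.toReal_ofReal hp0.le, ← ENNReal.rpow_mul, one_div, inv_mul_cancel₀ hp0.ne',
      ENNReal.rpow_one]
  rcases hp2.eq_or_lt with rfl | hp2
  -- At p = 2 all powers with exponent 2 - p equal 1, including 0⁰, and Bessel's inequality
  -- suffices.
  · refine ⟨1, fun σ _ f hf => ?_⟩
    rw [hnorm]
    have hf2 : MemLp f 2 SU2.haar := by simpa using hf
    simpa [show (2 : ℝ) * (1 - 2⁻¹) = 1 by norm_num] using SU2.tsum_hsNorm_fourier_sq_le hf2
  · refine ⟨Real.toNNReal (4 * p / (p - 1) + 4 * p / (2 - p)), fun σ hσ f hf => ?_⟩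
    have h2p : 0 < 2 - p := by linarith
    have hp1' : 0 < p - 1 := by linarith
    by_cases hK : SU2.paleyConst σ = 0
    · simp [SU2.opNorm_eq_zero_of_paleyConst_eq_zero hK, Real.zero_rpow h2p.ne']
    have hKpos : 0 < (SU2.paleyConst σ).toReal := ENNReal.toReal_pos hK hσ.ne
    -- A measurable representative makes the cut sets measurable.
    obtain ⟨g, hgm, hfg⟩ := hf.aestronglyMeasurable
    rw [SU2.fourier_congr_ae hfg, eLpNorm_congr_ae hfg, hnorm]
    have hgi : Integrable g SU2.haar :=
      ((memLp_congr_ae hfg).1 hf).integrable (by simpa using hp1.le)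
    refine (ENNReal.tsum_le_tsum fun n => SU2.summand_le_paleyWeight_mul hp0 hp2 g n).trans
      ((tsum_weight_mul_rpow_le hKpos (fun _ _ hg hh n => SU2.paleyOp_add_le hg hh n)
        (fun _ hg _ ht => SU2.tsum_paleyWeight_paleyOp_gt_le hσ.ne hg ht)
        (fun _ hg => SU2.tsum_paleyWeight_mul_paleyOp_sq_le hg) hp1 hp2 hgm.measurable hgi).trans
        (le_of_eq ?_))
    rw [ENNReal.ofReal_mul (by positivity), ← ENNReal.ofReal_rpow_of_pos hKpos,
      ENNReal.ofReal_toReal hσ.ne]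
    rfl
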